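/- Let $D\subseteq\mathbb Z^2$. For $G$ defined on $D$ and an elementary quadrilateral $(i,j,k,l)=((m,n),(m+1,n),(m+1,n+1),(m,n+1))$ of $D$ put $G_x=\tfrac12(G_j+G_k)-\tfrac12(G_i+G_l)$ and $G_y=\tfrac12(G_k+G_l)-\tfrac12(G_i+G_j)$. A *discrete asymptotic net* on $D$ is a map $\tilde F:D\to\mathbb R^3$ such that for every $(m,n)\in D$ the point $\tilde F_{m,n}$ and its (at most four) neighbours $\tilde F_{m\pm1,n},\tilde F_{m,n\pm1}$ with index in $D$ are coplanar, while the four points $\tilde F_i,\tilde F_j,\tilde F_k,\tilde F_l$ of any elementary quadrilateral of $D$ are not coplanar. A *Gauss map* of $\tilde F$ is a map $N:D\to S^2$ such that $N_{m,n}$ is normal to the plane through $\tilde F_{m,n}$ and its neighbours; then $(\tilde F,N)$ is an edge-constraint net: $(\tilde F_q-\tilde F_p)\perp\tfrac12(N_p+N_q)$ on every edge $pq$. With $\nu=\frac{N_x\times N_y}{\|N_x\times N_y\|}$ and the mixed area $A(G,H)=\tfrac12\big(\det(G_x,H_y,\nu)+\det(H_x,G_y,\nu)\big)$ on a quadrilateral,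 the mean curvature of an edge-constraint net $(\tilde F,N)$ is $A(\tilde F,N)/A(\tilde F,\tilde F)$; it is defined if $N_x,N_y$ are linearly independent and $A(\tilde F,\tilde F)\ne0$. We call $\tilde F$ (with Gauss map $N$) a *discrete asymptotic minimal net* on $D$ if it is a discrete asymptotic net whose mean curvature is defined and equal to $0$ on every elementary quadrilateral of $D$. **Theorem.** Let $n_0\in\mathbb Z$, $D=\{(m,n)\in\mathbb Z^2:n\le n_0\}$, and let $\tilde F:D\to\mathbb R^3$ be a discrete asymptotic minimal net with Gauss map $N$. Suppose that the discrete asymptotic line $m\mapsto\tilde F_{m,n_0}$ is contained in a straight line $\ell$. Extend $\tilde F$ to $\mathbb Z^2$ symmetrically with respect to $\ell$: for $n>n_0$ let $\tilde F_{m,n}$ be the image of $\tilde F_{m,2n_0-n}$ under the rotation by $180^\circ$ about $\ell$. Then the extended net is a discrete asymptotic minimal net on $\mathbb Z^2$, with respect to a Gauss map that extends $N$. -/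

import Mathlib

/-- Euclidean three-space. -/
abbrev E3 : Type := EuclideanSpace ℝ (Fin 3)

namespace DiscreteNet

/-- The cross product on Euclidean three-space. -/
def cross (u v : E3) : E3 := WithLp.toLp 2 (crossProduct u.ofLp v.ofLp)

/-- The determinant of three vectors of Euclidean three-space. -/
def det3 (u v w : E3) : ℝ := Matrix.det (Matrix.of ![u.ofLp, v.ofLp, w.ofLp])

/-- The (at most) five lattice points `(m,n), (m+1,n), (m-1,n), (m,n+1), (m,n-1)` that lie in the
domain `D`: a vertex together with its neighbours. -/
def vertexStar (D : Set (ℤ × ℤ)) (p : ℤ × ℤ) : Set (ℤ × ℤ) :=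
  {q | q ∈ D ∧ (q = p ∨ q = (p.1 + 1, p.2) ∨ q = (p.1 - 1, p.2) ∨
    q = (p.1, p.2 + 1) ∨ q = (p.1, p.2 - 1))}

/-- The vertices of the elementary quadrilateral with lower left corner `p`. -/
def quad (p : ℤ × ℤ) : Set (ℤ × ℤ) :=
  {p, (p.1 + 1, p.2), (p.1 + 1, p.2 + 1), (p.1, p.2 + 1)}

/-- `F`, restricted to the domain `D`, is a (non-degenerate) discrete asymptotic net: each vertex is
coplanar with its neighbours, and no elementary quadrilateral is planar. Only the values of `F`
on `D` matter. -/
structure IsAsymptoticNet (D : Set (ℤ × ℤ)) (F : ℤ × ℤ → E3) : Prop where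
  coplanar_star : ∀ p ∈ D, Coplanar ℝ (F '' vertexStar D p)
  nondegenerate : ∀ p, quad p ⊆ D → ¬ Coplanar ℝ (F '' quad p)

/-- `N` is a Gauss map on `D` of the discrete asymptotic net `F`: at each vertex it is a unit normal
of the plane through the vertex and its neighbours. -/
structure IsGaussMap (D : Set (ℤ × ℤ)) (F N : ℤ × ℤ → E3) : Prop where
  norm_eq_one : ∀ p ∈ D, ‖N p‖ = 1
  normal : ∀ p ∈ D, ∀ q ∈ vertexStar D p, inner ℝ (N p) (F q - F p) = 0

/-- `(F, N)` is an edge-constraint net on `D`: `N` takes values in the unit sphere, and along each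
edge the mean of the two normals is perpendicular to the edge. -/
structure IsEdgeConstraintNet (D : Set (ℤ × ℤ)) (F N : ℤ × ℤ → E3) : Prop where
  norm_eq_one : ∀ p ∈ D, ‖N p‖ = 1
  edge_constraint : ∀ p ∈ D, ∀ q ∈ vertexStar D p,
    inner ℝ (F q - F p) ((1 / 2 : ℝ) • (N p + N q)) = 0

/-- First discrete partial derivative on the elementary quadrilateral at `p` (the vector joining the
midpoints of two opposite edges). -/
noncomputable def dx (G : ℤ × ℤ → E3) (p : ℤ × ℤ) : E3 :=
  (1 / 2 : ℝ) • (G (p.1 + 1, p.2) + G (p.1 + 1, p.2 + 1)) -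
    (1 / 2 : ℝ) • (G p + G (p.1, p.2 + 1))

/-- Second discrete partial derivative on the elementary quadrilateral at `p`. -/
noncomputable def dy (G : ℤ × ℤ → E3) (p : ℤ × ℤ) : E3 :=
  (1 / 2 : ℝ) • (G (p.1, p.2 + 1) + G (p.1 + 1, p.2 + 1)) -
    (1 / 2 : ℝ) • (G p + G (p.1 + 1, p.2))

/-- The unit normal of the elementary quadrilateral at `p`: the normalized `N_x × N_y`
(it is `0` if `N_x` and `N_y` are linearly dependent). -/
noncomputable def quadNormal (N : ℤ × ℤ → E3) (p : ℤ × ℤ) : E3 :=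
  ‖cross (dx N p) (dy N p)‖⁻¹ • cross (dx N p) (dy N p)

/-- The mixed area of `G` and `H` on the elementary quadrilateral at `p`, after projection along the
unit normal of the quadrilateral. -/
noncomputable def mixedArea (N G H : ℤ × ℤ → E3) (p : ℤ × ℤ) : ℝ :=
  (1 / 2 : ℝ) * (det3 (dx G p) (dy H p) (quadNormal N p) +
    det3 (dx H p) (dy G p) (quadNormal N p))

/-- The mean curvature of the edge-constraint net `(F, N)` on the elementary quadrilateral at `p`. It
is meaningful where `mixedArea N F F p ≠ 0`. -/
noncomputable def meanCurvature (F N : ℤ × ℤ → E3) (p : ℤ × ℤ) : ℝ :=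
  mixedArea N F N p / mixedArea N F F p

/-- `(F, N)` is a minimal edge-constraint net on `D`: on each elementary quadrilateral of `D` the
mean curvature is defined and vanishes. The condition `mixedArea N F F p ≠ 0` includes that
`N_x` and `N_y` are linearly independent, so that the normal of the quadrilateral exists. -/
structure IsMinimalEdgeConstraintNet (D : Set (ℤ × ℤ)) (F N : ℤ × ℤ → E3) : Prop
    extends IsEdgeConstraintNet D F N where
  area_ne_zero : ∀ p, quad p ⊆ D → mixedArea N F F p ≠ 0
  meanCurvature_eq_zero : ∀ p, quad p ⊆ D → meanCurvature F N p = 0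

/-- `F` with Gauss map `N` is a discrete asymptotic minimal net on `D`. -/
structure IsAsymptoticMinimalNet (D : Set (ℤ × ℤ)) (F N : ℤ × ℤ → E3) : Prop where
  asymptotic : IsAsymptoticNet D F
  gauss : IsGaussMap D F N
  minimal : IsMinimalEdgeConstraintNet D F N

/-- The half-lattice `n ≤ n₀`. -/
def halfLattice (n₀ : ℤ) : Set (ℤ × ℤ) := {p | p.2 ≤ n₀}

open Classical in
/-- The extension of a net from the half-lattice `n ≤ n₀` to the whole lattice that is symmetric
with respect to the line `ℓ`: the value at `(m, n)` with `n > n₀` is the image of the value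
at `(m, 2 n₀ - n)` under the reflection in `ℓ`, which for a line in three-space is the rotation by
180 degrees about the line. It depends only on the values of `F` on the half-lattice. -/
noncomputable def lineExtension (n₀ : ℤ) (ℓ : AffineSubspace ℝ E3) [Nonempty ℓ]
    (F : ℤ × ℤ → E3) (p : ℤ × ℤ) : E3 :=
  if p ∈ halfLattice n₀ then F p else EuclideanGeometry.reflection ℓ (F (p.1, 2 * n₀ - p.2))

end DiscreteNet

namespace DiscreteNet

/-! ### Determinants and cross products under linear isometries -/

/-! Let `R` be the linear part of the rotation about `ℓ`. Nondegeneracy makes the boundary edges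
nonzero, so along `ℓ` the normals are orthogonal to `ℓ` and `R` negates them
(`gauss_mem_orthogonal`). Hence extending the Gauss map by `-R N` is consistent on the boundary, and
the extended pair is equivariant under `mirror` on all of the lattice. No quadrilateral crosses the
line, so each upper one mirrors a lower one: the mixed area of `F` with itself is unchanged, that of
`F` with `N` changes sign, and vanishing mean curvature is preserved (`meanCurvature_of_mirror`). At
a boundary vertex the new neighbour is the rotated lower one, so it stays in the tangent plane. -/

theorem inner_cross_eq_det3 (u v w : E3) : inner ℝ (cross u v) w = det3 u v w := by
  simp [cross, det3, Matrix.det_fin_three, cross_apply, PiLp.inner_apply, Fin.sum_univ_three]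
  ring

theorem det3_eq_basis_det (u v w : E3) :
    det3 u v w = (EuclideanSpace.basisFun (Fin 3) ℝ).toBasis.det ![u, v, w] := by
  rw [Module.Basis.det_apply, det3, ← Matrix.det_transpose]
  congr 1
  ext i j
  fin_cases j <;> simp [Module.Basis.toMatrix_apply]

theorem det3_map (R : E3 →ₗ[ℝ] E3) (u v w : E3) :
    det3 (R u) (R v) (R w) = LinearMap.det R * det3 u v w := by
  rw [det3_eq_basis_det, det3_eq_basis_det, ← Module.Basis.det_comp]
  congr 1
  ext i
  fin_cases i <;> rfl

/-- Paired with an arbitrary `R w`, both sides become determinants. -/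
theorem cross_map (R : E3 ≃ₗᵢ[ℝ] E3) (u v : E3) :
    cross (R u) (R v) = LinearMap.det (R : E3 →ₗ[ℝ] E3) • R (cross u v) := by
  refine ext_inner_right ℝ fun w => ?_
  obtain ⟨w, rfl⟩ := R.surjective w
  rw [inner_cross_eq_det3, real_inner_smul_left, R.inner_map_map, inner_cross_eq_det3]
  exact det3_map (R : E3 →ₗ[ℝ] E3) u v w

theorem cross_neg_left (u v : E3) : cross (-u) v = -cross u v := by
  simp only [cross, WithLp.ofLp_neg, map_neg, LinearMap.neg_apply, WithLp.toLp_neg]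

theorem det3_neg_left (u v w : E3) : det3 (-u) v w = -det3 u v w := by
  rw [← inner_cross_eq_det3, ← inner_cross_eq_det3, cross_neg_left, inner_neg_left]

theorem det3_neg_middle (u v w : E3) : det3 u (-v) w = -det3 u v w := by
  rw [← inner_cross_eq_det3, ← inner_cross_eq_det3, ← inner_neg_left]
  simp only [cross, WithLp.ofLp_neg, map_neg, WithLp.toLp_neg]

theorem det3_smul_right (c : ℝ) (u v w : E3) : det3 u v (c • w) = c * det3 u v w := by
  rw [← inner_cross_eq_det3, ← inner_cross_eq_det3, real_inner_smul_right]

/-! ### Coplanarity -/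

theorem coplanar_of_inner_eq_zero {s : Set E3} {a n : E3} (hn : n ≠ 0)
    (h : ∀ x ∈ s, inner ℝ n (x - a) = 0) : Coplanar ℝ s := by
  have : Fact (Module.finrank ℝ E3 = 2 + 1) := ⟨by simp⟩
  rw [coplanar_iff_finrank_le_two, ← Submodule.finrank_orthogonal_span_singleton (𝕜 := ℝ) (n := 2) hn]
  refine Submodule.finrank_mono (Submodule.span_le.2 ?_)
  rintro _ ⟨x, hx, y, hy, rfl⟩
  rw [SetLike.mem_coe, Submodule.mem_orthogonal_singleton_iff_inner_right]
  change inner ℝ n (x - y) = 0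
  rw [← sub_sub_sub_cancel_right x y a, inner_sub_right, h x hx, h y hy, sub_zero]

theorem coplanar_image {s : Set E3} (f : E3 →ᵃ[ℝ] E3) (h : Coplanar ℝ s) :
    Coplanar ℝ (f '' s) := by
  rw [coplanar_iff_finrank_le_two] at h ⊢
  rw [← AffineMap.map_vectorSpan]
  exact (Submodule.finrank_map_le _ _).trans h

/-! ### Consequences of the Gauss map -/

/-- Adjacency is symmetric, so both end normals are orthogonal to the edge, and so is their mean. -/
theorem IsGaussMap.isEdgeConstraintNet {F N : ℤ × ℤ → E3} (h : IsGaussMap Set.univ F N) :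
    IsEdgeConstraintNet Set.univ F N where
  norm_eq_one := h.norm_eq_one
  edge_constraint p _ q hq := by
    have hqp : p ∈ vertexStar Set.univ q := by
      obtain ⟨a, b⟩ := p
      obtain ⟨c, d⟩ := q
      simp only [vertexStar, Set.mem_ofPred_eq, Set.mem_univ, true_and, Prod.mk.injEq] at hq ⊢
      omega
    have h₁ := h.normal p trivial q hq
    have h₂ := h.normal q trivial p hqp
    rw [← neg_sub, inner_neg_right, neg_eq_zero] at h₂
    rw [real_inner_smul_right, inner_add_right, real_inner_comm, h₁, real_inner_comm, h₂]
    simp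

theorem IsGaussMap.coplanar_star {D : Set (ℤ × ℤ)} {F N : ℤ × ℤ → E3} (h : IsGaussMap D F N)
    {p : ℤ × ℤ} (hp : p ∈ D) : Coplanar ℝ (F '' vertexStar D p) := by
  refine coplanar_of_inner_eq_zero (n := N p) (a := F p) ?_ ?_
  · rw [← norm_ne_zero_iff, h.norm_eq_one p hp]
    exact one_ne_zero
  · rintro _ ⟨q, hq, rfl⟩
    exact h.normal p hp q hq

theorem quad_subset_halfLattice {n₀ : ℤ} {p : ℤ × ℤ} (hp : p.2 < n₀) :
    quad p ⊆ halfLattice n₀ := by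
  rintro q (rfl | rfl | rfl | rfl) <;> simp only [halfLattice, Set.mem_ofPred_eq] <;> omega

/-! ### The symmetry of the lattice -/

/-- The reflection of the lattice in the horizontal line `n = n₀`. -/
def mirror (n₀ : ℤ) (p : ℤ × ℤ) : ℤ × ℤ := (p.1, 2 * n₀ - p.2)

/-- The lower left corner of the mirror image of the elementary quadrilateral at `p`. -/
def mirrorCorner (n₀ : ℤ) (p : ℤ × ℤ) : ℤ × ℤ := (p.1, 2 * n₀ - p.2 - 1)

theorem mirror_mem_vertexStar (n₀ : ℤ) {p q : ℤ × ℤ} (h : q ∈ vertexStar Set.univ p) :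
    mirror n₀ q ∈ vertexStar Set.univ (mirror n₀ p) := by
  obtain ⟨a, b⟩ := p
  obtain ⟨c, d⟩ := q
  simp only [mirror, vertexStar, Set.mem_ofPred_eq, Set.mem_univ, true_and, Prod.mk.injEq] at h ⊢
  omega

/-- The mirror swaps lower and upper edges, hence the shift by one in `mirrorCorner`. -/
theorem image_mirror_quad (n₀ : ℤ) (p : ℤ × ℤ) :
    mirror n₀ '' quad (mirrorCorner n₀ p) = quad p := by
  obtain ⟨a, b⟩ := p
  have h₁ : 2 * n₀ - (2 * n₀ - b - 1) = b + 1 := by ring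
  have h₂ : 2 * n₀ - (2 * n₀ - b - 1 + 1) = b := by ring
  simp only [quad, mirrorCorner, Set.image_insert_eq, Set.image_singleton, mirror, h₁, h₂]
  ext q
  simp only [Set.mem_insert_iff, Set.mem_singleton_iff]
  tauto

/-- The partial derivatives of a function whose increments are equivariant under `mirror`. -/
theorem dx_of_mirror {n₀ : ℤ} {G : ℤ × ℤ → E3} {R : E3 →ₗ[ℝ] E3}
    (h : ∀ p q, G (mirror n₀ p) - G (mirror n₀ q) = R (G p - G q)) (p : ℤ × ℤ) :
    dx G p = R (dx G (mirrorCorner n₀ p)) := by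
  obtain ⟨a, b⟩ := p
  have h₁ := h (a + 1, 2 * n₀ - b - 1) (a, 2 * n₀ - b - 1)
  have h₂ := h (a + 1, 2 * n₀ - b - 1 + 1) (a, 2 * n₀ - b - 1 + 1)
  have e₁ : 2 * n₀ - (2 * n₀ - b - 1) = b + 1 := by ring
  have e₂ : 2 * n₀ - (2 * n₀ - b - 1 + 1) = b := by ring
  simp only [mirror, e₁, e₂] at h₁ h₂
  calc dx G (a, b) = (1 / 2 : ℝ) • ((G (a + 1, b + 1) - G (a, b + 1)) +
        (G (a + 1, b) - G (a, b))) := by simp only [dx]; module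
    _ = R (dx G (mirrorCorner n₀ (a, b))) := by
      rw [h₁, h₂, ← map_add, ← map_smul]
      congr 1
      simp only [dx, mirrorCorner]
      module

/-- The sign comes from the exchange of lower and upper edges. -/
theorem dy_of_mirror {n₀ : ℤ} {G : ℤ × ℤ → E3} {R : E3 →ₗ[ℝ] E3}
    (h : ∀ p q, G (mirror n₀ p) - G (mirror n₀ q) = R (G p - G q)) (p : ℤ × ℤ) :
    dy G p = -R (dy G (mirrorCorner n₀ p)) := by
  obtain ⟨a, b⟩ := p
  have h₁ := h (a, 2 * n₀ - b - 1) (a, 2 * n₀ - b - 1 + 1)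
  have h₂ := h (a + 1, 2 * n₀ - b - 1) (a + 1, 2 * n₀ - b - 1 + 1)
  have e₁ : 2 * n₀ - (2 * n₀ - b - 1) = b + 1 := by ring
  have e₂ : 2 * n₀ - (2 * n₀ - b - 1 + 1) = b := by ring
  simp only [mirror, e₁, e₂] at h₁ h₂
  calc dy G (a, b) = (1 / 2 : ℝ) • ((G (a, b + 1) - G (a, b)) +
        (G (a + 1, b + 1) - G (a + 1, b))) := by simp only [dy]; module
    _ = -R (dy G (mirrorCorner n₀ (a, b))) := by
      rw [h₁, h₂, ← map_add, ← map_smul, ← map_neg]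
      congr 1
      simp only [dy, mirrorCorner]
      module

/-! ### Curvature under a mirror symmetry -/

section Equivariant

variable {n₀ : ℤ} {F N : ℤ × ℤ → E3} {R : E3 ≃ₗᵢ[ℝ] E3}

theorem quadNormal_of_mirror (hR : LinearMap.det (R : E3 →ₗ[ℝ] E3) ^ 2 = 1)
    (hN : ∀ p, N (mirror n₀ p) = -R (N p)) (p : ℤ × ℤ) :
    quadNormal N p =
      -(LinearMap.det (R : E3 →ₗ[ℝ] E3)) • R (quadNormal N (mirrorCorner n₀ p)) := by
  have hN' : ∀ p q, N (mirror n₀ p) - N (mirror n₀ q) = (-(R : E3 →ₗ[ℝ] E3)) (N p - N q) := by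
    intro p q
    simp [hN]
    abel
  have hd : |LinearMap.det (R : E3 →ₗ[ℝ] E3)| = 1 := by
    rwa [← sq_eq_sq₀ (abs_nonneg _) zero_le_one, sq_abs, one_pow]
  have hc : cross (dx N p) (dy N p) = -(LinearMap.det (R : E3 →ₗ[ℝ] E3)) •
      R (cross (dx N (mirrorCorner n₀ p)) (dy N (mirrorCorner n₀ p))) := by
    rw [dx_of_mirror hN', dy_of_mirror hN', neg_smul, ← cross_map, ← cross_neg_left]
    simp
  rw [quadNormal, quadNormal, hc, norm_smul, norm_neg, Real.norm_eq_abs, hd, one_mul, R.norm_map,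
    map_smul, smul_comm]

/-- The factor `det R` of the determinant meets the `-det R` of the normal, so only the square of
`det R` enters. -/
theorem det3_quadNormal_of_mirror (hR : LinearMap.det (R : E3 →ₗ[ℝ] E3) ^ 2 = 1)
    (hN : ∀ p, N (mirror n₀ p) = -R (N p)) (p : ℤ × ℤ) (u v : E3) :
    det3 (R u) (R v) (quadNormal N p) = -det3 u v (quadNormal N (mirrorCorner n₀ p)) := by
  have h : det3 (R u) (R v) (R _) = _ :=
    det3_map (R : E3 →ₗ[ℝ] E3) u v (quadNormal N (mirrorCorner n₀ p))
  rw [quadNormal_of_mirror hR hN, det3_smul_right, h]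
  linear_combination (-det3 u v (quadNormal N (mirrorCorner n₀ p))) * hR

theorem mixedArea_self_of_mirror (hR : LinearMap.det (R : E3 →ₗ[ℝ] E3) ^ 2 = 1)
    (hF : ∀ p q, F (mirror n₀ p) - F (mirror n₀ q) = R (F p - F q))
    (hN : ∀ p, N (mirror n₀ p) = -R (N p)) (p : ℤ × ℤ) :
    mixedArea N F F p = mixedArea N F F (mirrorCorner n₀ p) := by
  have hx : dx F p = R _ := dx_of_mirror (R := (R : E3 →ₗ[ℝ] E3)) hF p
  have hy : dy F p = -R _ := dy_of_mirror (R := (R : E3 →ₗ[ℝ] E3)) hF p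
  simp only [mixedArea, hx, hy, det3_neg_middle, det3_quadNormal_of_mirror hR hN, neg_neg]

/-- Compared with `mixedArea_self_of_mirror`, the minus sign in `hN` contributes one more sign to
each term. -/
theorem mixedArea_gauss_of_mirror (hR : LinearMap.det (R : E3 →ₗ[ℝ] E3) ^ 2 = 1)
    (hF : ∀ p q, F (mirror n₀ p) - F (mirror n₀ q) = R (F p - F q))
    (hN : ∀ p, N (mirror n₀ p) = -R (N p)) (p : ℤ × ℤ) :
    mixedArea N F N p = -mixedArea N F N (mirrorCorner n₀ p) := by
  have hN' : ∀ p q, N (mirror n₀ p) - N (mirror n₀ q) = (-(R : E3 →ₗ[ℝ] E3)) (N p - N q) := by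
    intro p q
    simp [hN]
    abel
  have hx : dx F p = R _ := dx_of_mirror (R := (R : E3 →ₗ[ℝ] E3)) hF p
  have hy : dy F p = -R _ := dy_of_mirror (R := (R : E3 →ₗ[ℝ] E3)) hF p
  have hNx : dx N p = -R _ := dx_of_mirror hN' p
  have hNy : dy N p = - -R _ := dy_of_mirror hN' p
  simp only [mixedArea, hx, hy, hNx, hNy, det3_neg_middle, det3_neg_left,
    det3_quadNormal_of_mirror hR hN, neg_neg]
  ring

theorem meanCurvature_of_mirror (hR : LinearMap.det (R : E3 →ₗ[ℝ] E3) ^ 2 = 1)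
    (hF : ∀ p q, F (mirror n₀ p) - F (mirror n₀ q) = R (F p - F q))
    (hN : ∀ p, N (mirror n₀ p) = -R (N p)) (p : ℤ × ℤ) :
    meanCurvature F N p = -meanCurvature F N (mirrorCorner n₀ p) := by
  rw [meanCurvature, meanCurvature, mixedArea_gauss_of_mirror hR hF hN,
    mixedArea_self_of_mirror hR hF hN, neg_div]

end Equivariant

/-! ### Locality -/

theorem eqOn_quad {G G' : ℤ × ℤ → E3} {p : ℤ × ℤ} (h : Set.EqOn G G' (quad p)) :
    dx G p = dx G' p ∧ dy G p = dy G' p := by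
  have h₁ := h (show p ∈ quad p by simp [quad])
  have h₂ := h (show (p.1 + 1, p.2) ∈ quad p by simp [quad])
  have h₃ := h (show (p.1 + 1, p.2 + 1) ∈ quad p by simp [quad])
  have h₄ := h (show (p.1, p.2 + 1) ∈ quad p by simp [quad])
  simp only [dx, dy, h₁, h₂, h₃, h₄, and_self]

theorem mixedArea_congr {N N' G G' H H' : ℤ × ℤ → E3} {p : ℤ × ℤ}
    (hN : Set.EqOn N N' (quad p)) (hG : Set.EqOn G G' (quad p)) (hH : Set.EqOn H H' (quad p)) :
    mixedArea N G H p = mixedArea N' G' H' p := by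
  simp only [mixedArea, quadNormal, (eqOn_quad hN).1, (eqOn_quad hN).2, (eqOn_quad hG).1,
    (eqOn_quad hG).2, (eqOn_quad hH).1, (eqOn_quad hH).2]

/-! ### Symmetric nets -/

/-- A net on the lattice that is equivariant under the reflection of the lattice in `n = n₀` and a
rigid motion `ρ` is asymptotic minimal as soon as it is so on the half-lattice. -/
theorem isAsymptoticMinimalNet_of_mirror {n₀ : ℤ} {F N : ℤ × ℤ → E3} {ρ : E3 ≃ᵃⁱ[ℝ] E3}
    (hR : LinearMap.det (ρ.linearIsometryEquiv : E3 →ₗ[ℝ] E3) ^ 2 = 1)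
    (hF : ∀ p, F (mirror n₀ p) = ρ (F p))
    (hN : ∀ p, N (mirror n₀ p) = -ρ.linearIsometryEquiv (N p))
    (h : IsAsymptoticMinimalNet (halfLattice n₀) F N) :
    IsAsymptoticMinimalNet Set.univ F N := by
  have hF' : ∀ p q, F (mirror n₀ p) - F (mirror n₀ q) = ρ.linearIsometryEquiv (F p - F q) := by
    intro p q
    rw [hF, hF, ← vsub_eq_sub, ← vsub_eq_sub, ρ.map_vsub]
  -- The line `n = n₀` is a lattice line, so every quadrilateral lies on one side of it.
  have induct : ∀ P : ℤ × ℤ → Prop, (∀ p, p.2 < n₀ → P p) → (∀ p, P (mirrorCorner n₀ p) → P p) →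
      ∀ p, P p := by
    intro P h₁ h₂ p
    by_cases hp : p.2 < n₀
    · exact h₁ p hp
    · refine h₂ p (h₁ _ ?_)
      simp only [mirrorCorner]
      omega
  have normal_half : ∀ p ∈ halfLattice n₀, ∀ q ∈ vertexStar Set.univ p,
      inner ℝ (N p) (F q - F p) = 0 := by
    intro p hp q hq
    by_cases hqD : q ∈ halfLattice n₀
    · exact h.gauss.normal p hp q ⟨hqD, hq.2⟩
    -- Here `p` is on the boundary and `q` just above it, so `p` is fixed and `q` mirrors a lower
    -- neighbour.
    · have hpn : mirror n₀ p = p := by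
        obtain ⟨a, b⟩ := p
        obtain ⟨c, d⟩ := q
        simp only [halfLattice, mirror, vertexStar, Set.mem_ofPred_eq, Set.mem_univ, true_and,
          Prod.mk.injEq] at hp hqD hq ⊢
        omega
      have hqD' : mirror n₀ q ∈ halfLattice n₀ := by
        simp only [halfLattice, mirror, Set.mem_ofPred_eq] at hqD ⊢
        omega
      have hq' := mirror_mem_vertexStar n₀ hq
      rw [hpn] at hq'
      have h₁ := h.gauss.normal p hp _ ⟨hqD', hq'.2⟩
      have h₂ := hF' q p
      have h₃ := hN p
      rw [hpn] at h₂ h₃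
      rw [h₂, h₃, inner_neg_left, LinearIsometryEquiv.inner_map_map, neg_eq_zero] at h₁
      exact h₁
  have mirror_mem : ∀ p, p ∉ halfLattice n₀ → mirror n₀ p ∈ halfLattice n₀ := by
    intro p hp
    simp only [halfLattice, mirror, Set.mem_ofPred_eq] at hp ⊢
    omega
  have gauss : IsGaussMap Set.univ F N := by
    refine ⟨fun p _ => ?_, fun p _ q hq => ?_⟩
    · by_cases hp : p ∈ halfLattice n₀
      · exact h.gauss.norm_eq_one p hp
      · have := h.gauss.norm_eq_one _ (mirror_mem p hp)
        rwa [hN, norm_neg, LinearIsometryEquiv.norm_map] at this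
    · by_cases hp : p ∈ halfLattice n₀
      · exact normal_half p hp q hq
      · have := normal_half _ (mirror_mem p hp) _ (mirror_mem_vertexStar n₀ hq)
        rwa [hF', hN, inner_neg_left, LinearIsometryEquiv.inner_map_map, neg_eq_zero] at this
  refine ⟨⟨fun p hp => gauss.coplanar_star hp, ?_⟩, gauss, gauss.isEdgeConstraintNet, ?_, ?_⟩
  · refine fun p _ => induct (fun p => ¬ Coplanar ℝ (F '' quad p))
      (fun p hp => h.asymptotic.nondegenerate p (quad_subset_halfLattice hp)) (fun p hp hc => ?_) p
    refine hp ?_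
    have := coplanar_image (ρ.symm.toAffineEquiv : E3 →ᵃ[ℝ] E3) hc
    rw [← image_mirror_quad n₀, Set.image_image, Set.image_image] at this
    simpa [hF] using this
  · refine fun p _ => induct (fun p => mixedArea N F F p ≠ 0)
      (fun p hp => h.minimal.area_ne_zero p (quad_subset_halfLattice hp)) (fun p hp => ?_) p
    rwa [mixedArea_self_of_mirror hR hF' hN]
  · refine fun p _ => induct (fun p => meanCurvature F N p = 0)
      (fun p hp => h.minimal.meanCurvature_eq_zero p (quad_subset_halfLattice hp))
      (fun p hp => ?_) p
    rw [meanCurvature_of_mirror hR hF' hN, hp, neg_zero]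

/-- Transfers the hypothesis from `F`, `N`, whose values off `D` are arbitrary, to their extensions.
-/
theorem IsAsymptoticMinimalNet.congr {D : Set (ℤ × ℤ)} {F F' N N' : ℤ × ℤ → E3}
    (h : IsAsymptoticMinimalNet D F N) (hF : Set.EqOn F' F D) (hN : Set.EqOn N' N D) :
    IsAsymptoticMinimalNet D F' N' := by
  have hs : ∀ p, vertexStar D p ⊆ D := fun p q hq => hq.1
  refine ⟨⟨fun p hp => ?_, fun p hp => ?_⟩, ⟨fun p hp => ?_, fun p hp q hq => ?_⟩,
    ⟨fun p hp => ?_, fun p hp q hq => ?_⟩, fun p hp => ?_, fun p hp => ?_⟩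
  · rw [(hF.mono (hs p)).image_eq]
    exact h.asymptotic.coplanar_star p hp
  · rw [(hF.mono hp).image_eq]
    exact h.asymptotic.nondegenerate p hp
  · rw [hN hp]
    exact h.gauss.norm_eq_one p hp
  · rw [hN hp, hF hp, hF hq.1]
    exact h.gauss.normal p hp q hq
  · rw [hN hp]
    exact h.gauss.norm_eq_one p hp
  · rw [hN hp, hN hq.1, hF hp, hF hq.1]
    exact h.minimal.edge_constraint p hp q hq
  · rw [mixedArea_congr (hN.mono hp) (hF.mono hp) (hF.mono hp)]
    exact h.minimal.area_ne_zero p hp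
  · rw [meanCurvature, mixedArea_congr (hN.mono hp) (hF.mono hp) (hF.mono hp),
      mixedArea_congr (hN.mono hp) (hF.mono hp) (hN.mono hp)]
    exact h.minimal.meanCurvature_eq_zero p hp

/-! ### The reflection in a line -/

theorem det_reflection_sq (K : Submodule ℝ E3) :
    LinearMap.det (K.reflection : E3 →ₗ[ℝ] E3) ^ 2 = 1 := by
  rw [sq, ← LinearMap.det_comp]
  convert LinearMap.det_id (A := ℝ) (M := E3)
  ext1 x
  exact K.reflection_reflection x

theorem linearIsometryEquiv_reflection (ℓ : AffineSubspace ℝ E3) [Nonempty ℓ] :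
    (EuclideanGeometry.reflection ℓ).linearIsometryEquiv = ℓ.direction.reflection := by
  ext1 v
  rw [← vadd_vsub v (Classical.arbitrary ℓ : E3), AffineIsometryEquiv.map_vsub]
  simp [EuclideanGeometry.reflection_apply]

open Classical in
/-- The Gauss map of the symmetric extension: rotated and reversed beyond the line. -/
noncomputable def gaussExtension (n₀ : ℤ) (ℓ : AffineSubspace ℝ E3) (N : ℤ × ℤ → E3)
    (p : ℤ × ℤ) : E3 :=
  if p ∈ halfLattice n₀ then N p else -ℓ.direction.reflection (N (mirror n₀ p))

theorem lineExtension_mirror {n₀ : ℤ} {ℓ : AffineSubspace ℝ E3} [Nonempty ℓ] {F : ℤ × ℤ → E3}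
    (h : ∀ m : ℤ, F (m, n₀) ∈ ℓ) (p : ℤ × ℤ) :
    lineExtension n₀ ℓ F (mirror n₀ p) =
      EuclideanGeometry.reflection ℓ (lineExtension n₀ ℓ F p) := by
  obtain ⟨a, b⟩ := p
  rcases lt_trichotomy b n₀ with hb | rfl | hb
  · have h₁ : ¬ 2 * n₀ - b ≤ n₀ := by omega
    simp [lineExtension, halfLattice, mirror, hb.le, h₁]
  · have h₁ : 2 * b - b = b := by ring
    simp [lineExtension, halfLattice, mirror, h₁,
      (EuclideanGeometry.reflection_eq_self_iff _).2 (h a)]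
  · have h₁ : 2 * n₀ - b ≤ n₀ := by omega
    simp [lineExtension, halfLattice, mirror, hb.not_ge, h₁]

/-- Only `n = n₀` has content: there the reflection negates the normal and the outer minus sign
undoes this. -/
theorem gaussExtension_mirror {n₀ : ℤ} {ℓ : AffineSubspace ℝ E3} {N : ℤ × ℤ → E3}
    (h : ∀ m : ℤ, N (m, n₀) ∈ ℓ.directionᗮ) (p : ℤ × ℤ) :
    gaussExtension n₀ ℓ N (mirror n₀ p) =
      -ℓ.direction.reflection (gaussExtension n₀ ℓ N p) := by
  obtain ⟨a, b⟩ := p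
  rcases lt_trichotomy b n₀ with hb | rfl | hb
  · have h₁ : ¬ 2 * n₀ - b ≤ n₀ := by omega
    simp [gaussExtension, halfLattice, mirror, hb.le, h₁]
  · have h₁ : 2 * b - b = b := by ring
    simp [gaussExtension, halfLattice, mirror, h₁,
      Submodule.reflection_mem_subspace_orthogonalComplement_eq_neg (h a)]
  · have h₁ : 2 * n₀ - b ≤ n₀ := by omega
    simp [gaussExtension, halfLattice, mirror, hb.not_ge, h₁]

/-- Along the boundary line the Gauss map is perpendicular to the line. -/
theorem gauss_mem_orthogonal {n₀ : ℤ} {F N : ℤ × ℤ → E3}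
    (hF : IsAsymptoticNet (halfLattice n₀) F) (hN : IsGaussMap (halfLattice n₀) F N)
    {ℓ : AffineSubspace ℝ E3} (hℓ : Module.finrank ℝ ℓ.direction = 1)
    (hline : ∀ m : ℤ, F (m, n₀) ∈ ℓ) (m : ℤ) : N (m, n₀) ∈ ℓ.directionᗮ := by
  have hne : F (m + 1, n₀) - F (m, n₀) ≠ 0 := by
    intro h0
    -- If the edge collapsed, the quadrilateral below it would have at most three distinct vertices.
    refine hF.nondegenerate (m, n₀ - 1) (quad_subset_halfLattice (by simp)) ?_
    simp only [quad, sub_add_cancel, Set.image_insert_eq, Set.image_singleton, sub_eq_zero.1 h0,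
      Set.pair_eq_singleton]
    exact coplanar_triple ℝ _ _ _
  have hmem : F (m + 1, n₀) - F (m, n₀) ∈ ℓ.direction :=
    AffineSubspace.vsub_mem_direction (hline _) (hline _)
  have horth : inner ℝ (N (m, n₀)) (F (m + 1, n₀) - F (m, n₀)) = 0 :=
    hN.normal _ (by simp [halfLattice]) _ (by simp [vertexStar, halfLattice])
  rw [Submodule.mem_orthogonal']
  intro v hv
  -- The nonzero edge spans the direction of `ℓ`.
  obtain ⟨c, hc⟩ := (finrank_eq_one_iff_of_nonzero'
    (⟨_, hmem⟩ : ℓ.direction) (by simpa using hne)).1 hℓ ⟨v, hv⟩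
  have hc' : c • (F (m + 1, n₀) - F (m, n₀)) = v := congrArg Subtype.val hc
  rw [← hc', real_inner_smul_right, horth, mul_zero]

end DiscreteNet

theorem theorem3 (n₀ : ℤ) (F N : ℤ × ℤ → E3)
    (hF : DiscreteNet.IsAsymptoticMinimalNet (DiscreteNet.halfLattice n₀) F N)
    (ℓ : AffineSubspace ℝ E3) [Nonempty ℓ] (hℓ : Module.finrank ℝ ℓ.direction = 1)
    (hline : ∀ m : ℤ, F (m, n₀) ∈ ℓ) :
    ∃ N' : ℤ × ℤ → E3, Set.EqOn N' N (DiscreteNet.halfLattice n₀) ∧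
      DiscreteNet.IsAsymptoticMinimalNet Set.univ (DiscreteNet.lineExtension n₀ ℓ F) N' := by
  have hNN : Set.EqOn (DiscreteNet.gaussExtension n₀ ℓ N) N (DiscreteNet.halfLattice n₀) :=
    fun p hp => if_pos hp
  have hFF : Set.EqOn (DiscreteNet.lineExtension n₀ ℓ F) F (DiscreteNet.halfLattice n₀) :=
    fun p hp => if_pos hp
  refine ⟨DiscreteNet.gaussExtension n₀ ℓ N, hNN,
    DiscreteNet.isAsymptoticMinimalNet_of_mirror (n₀ := n₀)
      (ρ := EuclideanGeometry.reflection ℓ) ?_ (DiscreteNet.lineExtension_mirror hline) ?_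
      (hF.congr hFF hNN)⟩
  · rw [DiscreteNet.linearIsometryEquiv_reflection]
    exact DiscreteNet.det_reflection_sq _
  · rw [DiscreteNet.linearIsometryEquiv_reflection]
    exact DiscreteNet.gaussExtension_mirror
      (DiscreteNet.gauss_mem_orthogonal hF.asymptotic hF.gauss hℓ hline)
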